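/- Let $(S,+)$ be a nonempty commutative semigroup and $G$ a group. A map $f:S\to G$ is a polynomial map of degree $\le 0$ if it is constant; inductively, it is a polynomial map of degree $\le d+1$ if for every $s\in S$ both maps $t\mapsto f(s+t)f(t)^{-1}$ and $t\mapsto f(t)^{-1}f(s+t)$ are polynomial maps of degree $\le d$. It is a polynomial map if it is a polynomial map of degree $\le d$ for some $d\ge 0$. For $N\ge 0$ the same definition applies to maps $f:S^N\to G$, where $S^N$ is the direct sum of $N$ copies of $S$ with coordinatewise addition. For $\sigma\in S_N$ (the symmetric group) put $\sigma(f)(s_1,\dots,s_N)=f(s_{\sigma(1)},\dots,s_{\sigma(N)})$; a polynomial map $f:S^N\to G$ is symmetric if $\sigma(f)=f$ for all $\sigma\in S_N$. For a map $h$ into $G$ let $\langle h\rangle$ be the subgroup of $G$ generated by the image of $h$. Theorem. Let $S$ be a nonempty commutative semigroup, $G$ a nilpotent group of class $n$, and $f:S^N\to G$ a polynomial map. Put $M=(N!)^n$. Then there is a sequence $\sigma_1,\dots,\sigma_M\in S_N$ such that the elementwise product $$\tilde f=\sigma_1(f)\sigma_2(f)\cdots\sigma_M(f):S^N\to G$$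 is a symmetric polynomial map and such that, moreover, the following holds: if $\langle f\rangle$ is finitely generated and the subgroup $\langle f|_S\rangle$ generated by the image of the restriction $f|_S:s\mapsto f(s,\dots,s)$ of $f$ to the diagonal has finite index in $\langle f\rangle$, then $\langle\tilde f\rangle$ is a subgroup of finite index of $\langle f\rangle$. -/

import Mathlib

namespace PolyMap

/-- The left forward difference `L_s(f) : t ↦ f (s + t) * (f t)⁻¹`. -/
def leftDiff {S G : Type*} [Add S] [Group G] (s : S) (f : S → G) : S → G :=
  fun t => f (s + t) * (f t)⁻¹

/-- The right forward difference `R_s(f) : t ↦ (f t)⁻¹ * f (s + t)`. -/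
def rightDiff {S G : Type*} [Add S] [Group G] (s : S) (f : S → G) : S → G :=
  fun t => (f t)⁻¹ * f (s + t)

/-- `f` is a polynomial map of degree at most `d`: the maps of degree at most `0` are the constant
ones (the constant `1`, of degree `-∞`, included), and `f` has degree at most `d + 1` if all its
left and right forward differences have degree at most `d`. -/
def IsPolynomialOfDegreeLE {S G : Type*} [Add S] [Group G] : ℕ → (S → G) → Prop
  | 0, f => ∃ g : G, ∀ t : S, f t = g
  | d + 1, f => ∀ s : S, IsPolynomialOfDegreeLE d (leftDiff s f) ∧
      IsPolynomialOfDegreeLE d (rightDiff s f)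

/-- A polynomial map is a map of degree at most `d` for some `d`. -/
def IsPolynomialMap {S G : Type*} [Add S] [Group G] (f : S → G) : Prop :=
  ∃ d : ℕ, IsPolynomialOfDegreeLE d f

/-- The action of the symmetric group on maps `S ^ N → G`:
`σ(f) (s₁, …, s_N) = f (s_{σ(1)}, …, s_{σ(N)})`. -/
def permAct {S G : Type*} {N : ℕ} (σ : Equiv.Perm (Fin N)) (f : (Fin N → S) → G) :
    (Fin N → S) → G :=
  fun s => f (fun i => s (σ i))

/-- A symmetric polynomial map `S ^ N → G`: a polynomial map fixed by every permutation. -/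
def IsSymmetricPolynomialMap {S G : Type*} [Add S] [Group G] {N : ℕ}
    (f : (Fin N → S) → G) : Prop :=
  IsPolynomialMap f ∧ ∀ τ : Equiv.Perm (Fin N), permAct τ f = f

/-- The ordered pointwise product `σ₁(f) σ₂(f) ⋯ σ_M(f)`. -/
def permProd {S G : Type*} [Group G] {N M : ℕ} (σ : Fin M → Equiv.Perm (Fin N))
    (f : (Fin N → S) → G) : (Fin N → S) → G :=
  fun s => (List.ofFn fun i : Fin M => permAct (σ i) f s).prod

/-- The restriction of `f : S ^ N → G` to the diagonal copy of `S`. -/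
def diagRestrict {S G : Type*} {N : ℕ} (f : (Fin N → S) → G) : S → G :=
  fun s => f (fun _ => s)

/-- The subgroup `⟨f⟩` of `G` generated by the image of `f`. -/
def imageSubgroup {X G : Type*} [Group G] (f : X → G) : Subgroup G :=
  Subgroup.closure (Set.range f)

/-- `H` is a subgroup of finite index of `K`, both being subgroups of `G`. -/
def IsFiniteIndexIn {G : Type*} [Group G] (H K : Subgroup G) : Prop :=
  H ≤ K ∧ (H.subgroupOf K).FiniteIndex

end PolyMap

/-! Three facts carry the theorem. Maps of bounded degree into a nilpotent group lie in a group of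
polynomial maps: give an iterated commutator of derivatives its total order as weight.
Differentiation raises weight, and large weight forces long commutators, which vanish
(`exists_subgroup_isPolynomialMap`). If `g` is symmetric modulo one term of the lower central
series, then modulo the next term its translates `σ(g)` commute, so their product over all `σ` is
symmetric there (`permListProd_univ_mem`). Iterating up to the class gives `N! ^ n` factors and a
symmetric map. On the diagonal this map is the `N! ^ n`-th power of `f`. In a finitely generated
nilpotent group, fixed positive powers of generators generate a subgroup of finite index
(`index_ne_zero_of_pow_mem`). -/

namespace PolyMap

open Subgroup
open scoped commutatorElement

/-! ### Commutators of lower central series terms -/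

section Group

variable {G : Type*} [Group G]

/-- The three subgroups lemma, modulo a normal subgroup. -/
theorem commutator_commutator_le_of_rotate {H₁ H₂ H₃ N : Subgroup G} [N.Normal]
    (h₁ : ⁅⁅H₂, H₃⁆, H₁⁆ ≤ N) (h₂ : ⁅⁅H₃, H₁⁆, H₂⁆ ≤ N) : ⁅⁅H₁, H₂⁆, H₃⁆ ≤ N := by
  have key : ∀ A B C : Subgroup G, ⁅⁅A, B⁆, C⁆ ≤ N ↔
      ⁅⁅A.map (QuotientGroup.mk' N), B.map (QuotientGroup.mk' N)⁆,
        C.map (QuotientGroup.mk' N)⁆ = ⊥ := by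
    intro A B C
    rw [← map_commutator, ← map_commutator, Subgroup.map_eq_bot_iff, QuotientGroup.ker_mk']
  rw [key] at h₁ h₂ ⊢
  exact commutator_commutator_eq_bot_of_rotate h₁ h₂

/-- Three subgroups and induction on `j`; the `+ 1` appears because the series is indexed from zero.
-/
theorem commutator_lowerCentralSeries_le (i j : ℕ) :
    ⁅(⊤ : Subgroup G).lowerCentralSeries i, (⊤ : Subgroup G).lowerCentralSeries j⁆ ≤
      (⊤ : Subgroup G).lowerCentralSeries (i + j + 1) := by
  induction j generalizing i with
  | zero => exact le_rfl
  | succ j ih =>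
    rw [commutator_comm, Subgroup.lowerCentralSeries_succ]
    apply commutator_commutator_le_of_rotate
    · rw [commutator_comm ⊤, ← Subgroup.lowerCentralSeries_succ]
      exact (ih (i + 1)).trans (le_of_eq (by congr 1; ring))
    · rw [show i + (j + 1) + 1 = (i + j + 1) + 1 by ring, Subgroup.lowerCentralSeries_succ _ (i + j + 1)]
      exact commutator_mono (ih i) le_rfl

end Group

/-! ### The weight filtration on polynomial maps -/

section Filtration

variable {T G : Type*} [Add T] [Group G]

/-- `IteratedCommutator d r k a`: up to inverses, `a` is an iterated commutator of `r` maps of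
degrees at most `d - k₁, …, d - k_r`, where `k = k₁ + ⋯ + k_r`. -/
inductive IteratedCommutator (d : ℕ) : ℕ → ℕ → (T → G) → Prop
  | of {k : ℕ} {f : T → G} (hk : k ≤ d) (hf : IsPolynomialOfDegreeLE (d - k) f) :
      IteratedCommutator d 1 k f
  | inv {r k : ℕ} {a : T → G} (ha : IteratedCommutator d r k a) : IteratedCommutator d r k a⁻¹
  | comm {r r' k k' : ℕ} {a b : T → G} (ha : IteratedCommutator d r k a)
      (hb : IteratedCommutator d r' k' b) : IteratedCommutator d (r + r') (k + k') ⁅a, b⁆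

/-- The filtration on the group generated by the maps of degree at most `d`, a derivative of order
`k` of such a map having weight `k`. -/
def polyFiltration (T G : Type*) [Add T] [Group G] (d i : ℕ) : Subgroup (T → G) :=
  closure {a | ∃ r k, i ≤ k ∧ IteratedCommutator d r k a}

variable {d i j r k : ℕ} {a b : T → G}

theorem IteratedCommutator.mem (ha : IteratedCommutator d r k a) (hi : i ≤ k) :
    a ∈ polyFiltration T G d i :=
  subset_closure ⟨r, k, hi, ha⟩

theorem polyFiltration_antitone : Antitone (polyFiltration T G d) := fun _ _ hij =>
  closure_mono fun _ ⟨r, k, hk, ha⟩ => ⟨r, k, hij.trans hk, ha⟩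

/-- `b * a * b⁻¹ = ⁅b, a⁆ * a`, and bracketing never lowers weight. -/
theorem IteratedCommutator.conj_mem (hb : IteratedCommutator d r k b)
    (ha : a ∈ polyFiltration T G d i) : b * a * b⁻¹ ∈ polyFiltration T G d i := by
  induction ha using closure_induction with
  | mem x hx =>
    obtain ⟨r', k', hk', hx⟩ := hx
    have h := mul_mem ((hb.comm hx).mem (i := i) (by lia)) (hx.mem hk')
    rwa [commutatorElement_def, inv_mul_cancel_right] at h
  | one => simp
  | mul x y _ _ hx hy => simpa [mul_assoc] using mul_mem hx hy
  | inv x _ hx => simpa [mul_assoc] using inv_mem hx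

theorem conj_mem_polyFiltration (hb : b ∈ polyFiltration T G d j)
    (ha : a ∈ polyFiltration T G d i) : b * a * b⁻¹ ∈ polyFiltration T G d i := by
  have h : polyFiltration T G d 0 ≤ normalizer (polyFiltration T G d i : Set (T → G)) := by
    rw [polyFiltration, closure_le]
    rintro c ⟨r, k, -, hc⟩
    refine mem_normalizer_iff.2 fun x => ⟨fun hx => hc.conj_mem hx, fun hx => ?_⟩
    simpa [mul_assoc] using hc.inv.conj_mem hx
  exact (mem_normalizer_iff.1 (h (polyFiltration_antitone (Nat.zero_le j) hb)) a).1 ha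

theorem commutator_mem_polyFiltration (ha : a ∈ polyFiltration T G d i)
    (hb : b ∈ polyFiltration T G d j) : ⁅a, b⁆ ∈ polyFiltration T G d (i + j) := by
  have gen : ∀ {r k : ℕ} {x : T → G}, i ≤ k → IteratedCommutator d r k x →
      ⁅x, b⁆ ∈ polyFiltration T G d (i + j) := by
    intro r k x hk hx
    induction hb using closure_induction with
    | mem y hy =>
      obtain ⟨r', k', hk', hy⟩ := hy
      exact (hx.comm hy).mem (by lia)
    | one => simp
    | mul y z hy _ ihy ihz =>
      rw [show ⁅x, y * z⁆ = ⁅x, y⁆ * (y * ⁅x, z⁆ * y⁻¹) by simp only [commutatorElement_def]; group]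
      exact mul_mem ihy (conj_mem_polyFiltration hy ihz)
    | inv y hy ihy =>
      rw [show ⁅x, y⁻¹⁆ = y⁻¹ * ⁅x, y⁆⁻¹ * y⁻¹⁻¹ by simp only [commutatorElement_def]; group]
      exact conj_mem_polyFiltration (inv_mem hy) (inv_mem ihy)
  induction ha using closure_induction with
  | mem x hx =>
    obtain ⟨r, k, hk, hx⟩ := hx
    exact gen hk hx
  | one => simp
  | mul x y hx _ ihx ihy =>
    rw [show ⁅x * y, b⁆ = (x * ⁅y, b⁆ * x⁻¹) * ⁅x, b⁆ by simp only [commutatorElement_def]; group]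
    exact mul_mem (conj_mem_polyFiltration hx ihy) ihx
  | inv x hx ihx =>
    rw [show ⁅x⁻¹, b⁆ = x⁻¹ * ⁅x, b⁆⁻¹ * x⁻¹⁻¹ by simp only [commutatorElement_def]; group]
    exact conj_mem_polyFiltration (inv_mem hx) (inv_mem ihx)

theorem IteratedCommutator.leftDiff_mem (ha : IteratedCommutator d r k a) (s : T) :
    leftDiff s a ∈ polyFiltration T G d (k + 1) := by
  induction ha with
  | @of k f hk hf =>
    rcases hk.lt_or_eq with hlt | rfl
    · rw [show d - k = (d - (k + 1)) + 1 by lia] at hf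
      exact (IteratedCommutator.of hlt (hf s).1).mem le_rfl
    -- At `k = d` the map is constant and no further derivative has a weight, but its difference is
    -- `1`.
    · rw [Nat.sub_self] at hf
      obtain ⟨g, hg⟩ := hf
      rw [show leftDiff s f = 1 by ext t; simp [leftDiff, hg]]
      exact one_mem _
  | @inv r k a ha ih =>
    rw [show leftDiff s a⁻¹ = a⁻¹ * (leftDiff s a)⁻¹ * a⁻¹⁻¹ by ext t; simp [leftDiff]]
    exact conj_mem_polyFiltration (ha.inv.mem le_rfl) (inv_mem ih)
  | @comm r r' k k' a b ha hb iha ihb =>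
    have ha' := ha.mem le_rfl
    have hb' := hb.mem le_rfl
    have hc := commutator_mem_polyFiltration ha' hb'
    generalize hu : leftDiff s a = u at iha
    generalize hv : leftDiff s b = v at ihb
    have hs : leftDiff s ⁅a, b⁆ = ⁅u * a, v * b⁆ * ⁅a, b⁆⁻¹ := by
      subst hu hv
      ext t
      simp [leftDiff, commutatorElement_def, mul_assoc]
    -- The shifts of `a` and `b` are `u * a` and `v * b`. Each factor on the right, up to
    -- conjugation, is a commutator of weight at least `k + k' + 1`.
    have e : ⁅u * a, v * b⁆ * ⁅a, b⁆⁻¹ = (u * ⁅a, v⁆ * u⁻¹) * ⁅u * v, ⁅a, b⁆⁆ *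
        (⁅a, b⁆ * ⁅u, v * b⁆ * ⁅a, b⁆⁻¹) := by
      simp only [commutatorElement_def]; group
    rw [hs, e]
    have h₁ := commutator_mem_polyFiltration ha' ihb
    have h₂ := commutator_mem_polyFiltration (mul_mem
      (polyFiltration_antitone (Nat.le_add_left 1 k) iha)
      (polyFiltration_antitone (Nat.le_add_left 1 k') ihb)) hc
    have h₃ := commutator_mem_polyFiltration iha
      (mul_mem (polyFiltration_antitone (Nat.le_succ k') ihb) hb')
    exact mul_mem (mul_mem (conj_mem_polyFiltration iha (polyFiltration_antitone (by lia) h₁))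
      (polyFiltration_antitone (by lia) h₂))
      (conj_mem_polyFiltration hc (polyFiltration_antitone (by lia) h₃))

theorem leftDiff_mem_polyFiltration (ha : a ∈ polyFiltration T G d i) (s : T) :
    leftDiff s a ∈ polyFiltration T G d (i + 1) := by
  induction ha using closure_induction with
  | mem x hx =>
    obtain ⟨r, k, hk, hx⟩ := hx
    exact polyFiltration_antitone (by lia) (hx.leftDiff_mem s)
  | one =>
    rw [show leftDiff s (1 : T → G) = 1 by ext t; simp [leftDiff]]
    exact one_mem _
  | mul x y hx _ ihx ihy =>
    rw [show leftDiff s (x * y) = leftDiff s x * (x * leftDiff s y * x⁻¹) by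
      ext t; simp [leftDiff, mul_assoc]]
    exact mul_mem ihx (conj_mem_polyFiltration hx ihy)
  | inv x hx ihx =>
    rw [show leftDiff s x⁻¹ = x⁻¹ * (leftDiff s x)⁻¹ * x⁻¹⁻¹ by ext t; simp [leftDiff]]
    exact conj_mem_polyFiltration (inv_mem hx) (inv_mem ihx)

theorem rightDiff_mem_polyFiltration (ha : a ∈ polyFiltration T G d i) (s : T) :
    rightDiff s a ∈ polyFiltration T G d (i + 1) := by
  rw [show rightDiff s a = a⁻¹ * leftDiff s a * a⁻¹⁻¹ by
    ext t; simp [leftDiff, rightDiff, mul_assoc]]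
  exact conj_mem_polyFiltration (inv_mem ha) (leftDiff_mem_polyFiltration ha s)

theorem IteratedCommutator.weight_le (ha : IteratedCommutator d r k a) :
    1 ≤ r ∧ k ≤ r * d ∧ ∀ t, a t ∈ (⊤ : Subgroup G).lowerCentralSeries (r - 1) := by
  induction ha with
  | of hk hf => exact ⟨le_rfl, by simpa using hk, fun t => mem_top _⟩
  | inv ha ih => exact ⟨ih.1, ih.2.1, fun t => inv_mem (ih.2.2 t)⟩
  | @comm r r' k k' a b ha hb iha ihb =>
    refine ⟨by lia, by nlinarith [iha.2.1, ihb.2.1], fun t => ?_⟩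
    have h := commutator_lowerCentralSeries_le _ _
      (commutator_mem_commutator (iha.2.2 t) (ihb.2.2 t))
    rwa [show r - 1 + (r' - 1) + 1 = r + r' - 1 by have := iha.1; have := ihb.1; lia] at h

/-- Each entry contributes weight at most `d`, so weight above `n * d` needs more than `n` entries.
-/
theorem polyFiltration_eq_bot {n : ℕ} (hn : (⊤ : Subgroup G).lowerCentralSeries n = ⊥) :
    polyFiltration T G d (n * d + 1) = ⊥ := by
  rw [eq_bot_iff, polyFiltration, closure_le]
  rintro a ⟨r, k, hk, ha⟩
  obtain ⟨-, hkr, hr⟩ := ha.weight_le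
  have hnr : n < r := by
    by_contra! h
    have := Nat.mul_le_mul_right d h
    lia
  refine mem_bot.2 (funext fun t => ?_)
  have h := Subgroup.lowerCentralSeries_antitone ⊤ (show n ≤ r - 1 by lia) (hr t)
  rwa [hn, mem_bot] at h

theorem isPolynomialOfDegreeLE_of_mem_polyFiltration {m : ℕ}
    (hm : polyFiltration T G d (i + m) = ⊥) (ha : a ∈ polyFiltration T G d i) :
    IsPolynomialOfDegreeLE m a := by
  induction m generalizing i a with
  | zero =>
    rw [Nat.add_zero] at hm
    rw [hm, mem_bot] at ha
    exact ⟨1, fun t => by rw [ha, Pi.one_apply]⟩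
  | succ m ih =>
    rw [← Nat.add_assoc, Nat.add_right_comm] at hm
    exact fun s => ⟨ih hm (leftDiff_mem_polyFiltration ha s),
      ih hm (rightDiff_mem_polyFiltration ha s)⟩

/-- Maps of degree at most `d` into a nilpotent group lie in a group of polynomial maps. -/
theorem exists_subgroup_isPolynomialMap [Group.IsNilpotent G] (T : Type*) [Add T] (d : ℕ) :
    ∃ Q : Subgroup (T → G), (∀ f, IsPolynomialOfDegreeLE d f → f ∈ Q) ∧
      ∀ f ∈ Q, IsPolynomialMap f := by
  refine ⟨polyFiltration T G d 0, fun f hf => (IteratedCommutator.of (Nat.zero_le d) hf).mem le_rfl,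
    fun f hf => ⟨Group.nilpotencyClass G * d + 1,
      isPolynomialOfDegreeLE_of_mem_polyFiltration ?_ hf⟩⟩
  rw [Nat.zero_add]
  exact polyFiltration_eq_bot Subgroup.lowerCentralSeries_nilpotencyClass

theorem IsPolynomialOfDegreeLE.comp {T' : Type*} [Add T'] {d : ℕ} {f : T → G}
    (hf : IsPolynomialOfDegreeLE d f) (φ : T' → T) (hφ : ∀ s t, φ (s + t) = φ s + φ t) :
    IsPolynomialOfDegreeLE d (f ∘ φ) := by
  induction d generalizing f with
  | zero =>
    obtain ⟨g, hg⟩ := hf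
    exact ⟨g, fun t => hg _⟩
  | succ d ih =>
    intro s
    rw [show leftDiff s (f ∘ φ) = leftDiff (φ s) f ∘ φ by ext t; simp [leftDiff, hφ],
      show rightDiff s (f ∘ φ) = rightDiff (φ s) f ∘ φ by ext t; simp [rightDiff, hφ]]
    exact ⟨ih (hf _).1, ih (hf _).2⟩

end Filtration

end PolyMap

namespace PolyMap

/-! ### Symmetrization along the lower central series -/

section Symmetrization

variable {S G : Type*} [Group G] {N : ℕ}

/-- The product of `σ(f)` over a list of permutations `σ`. -/
def permListProd (L : List (Equiv.Perm (Fin N))) (f : (Fin N → S) → G) : (Fin N → S) → G :=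
  fun s => (L.map fun σ => permAct σ f s).prod

/-- The `k`-fold concatenation of translates of the list of all permutations. -/
noncomputable def symmList (N : ℕ) : ℕ → List (Equiv.Perm (Fin N))
  | 0 => [1]
  | k + 1 => (Finset.univ : Finset (Equiv.Perm (Fin N))).toList.flatMap fun σ =>
      (symmList N k).map (σ * ·)

theorem length_symmList (N k : ℕ) : (symmList N k).length = N.factorial ^ k := by
  induction k with
  | zero => rfl
  | succ k ih =>
    simp [symmList, List.length_flatMap, ih, Fintype.card_perm, pow_succ']

theorem permListProd_flatMap_map (L₁ L₂ : List (Equiv.Perm (Fin N))) (f : (Fin N → S) → G)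
    (s : Fin N → S) :
    permListProd (L₁.flatMap fun σ => L₂.map (σ * ·)) f s =
      permListProd L₁ (permListProd L₂ f) s := by
  induction L₁ with
  | nil => rfl
  | cons σ L₁ ih =>
    simp only [permListProd, permAct, List.flatMap_cons, List.map_append, List.prod_append,
      List.map_cons, List.prod_cons, List.map_map] at ih ⊢
    rw [ih]
    rfl

theorem permListProd_const (L : List (Equiv.Perm (Fin N))) (f : (Fin N → S) → G) (s : S) :
    permListProd L f (fun _ => s) = f (fun _ => s) ^ L.length := by
  simp [permListProd, permAct]

/-- The product of all `σ(g)` is symmetric modulo a term of the lower central series following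
one modulo which `g` is symmetric. -/
theorem permListProd_univ_mem (g : (Fin N → S) → G) (k : ℕ)
    (hg : ∀ (τ : Equiv.Perm (Fin N)) (s : Fin N → S),
      (g s)⁻¹ * permAct τ g s ∈ (⊤ : Subgroup G).lowerCentralSeries k)
    (τ : Equiv.Perm (Fin N)) (s : Fin N → S) :
    (permListProd Finset.univ.toList g s)⁻¹ * permAct τ (permListProd Finset.univ.toList g) s ∈
      (⊤ : Subgroup G).lowerCentralSeries (k + 1) := by
  set π := QuotientGroup.mk' ((⊤ : Subgroup G).lowerCentralSeries (k + 1)) with hπ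
  -- Each `σ(g)(s)` is `g s` times an element central modulo the next term.
  have hcomm : ∀ σ ρ : Equiv.Perm (Fin N),
      Commute (π (permAct σ g s)) (π (permAct ρ g s)) := by
    have hcen : ∀ c ∈ (⊤ : Subgroup G).lowerCentralSeries k, ∀ x, Commute (π c) (π x) := by
      intro c hc x
      rw [← commutatorElement_eq_one_iff_commute, ← map_commutatorElement, ← MonoidHom.mem_ker,
        hπ, QuotientGroup.ker_mk']
      exact Subgroup.commutator_mem_commutator hc (Subgroup.mem_top x)
    intro σ ρ
    rw [← mul_inv_cancel_left (g s) (permAct σ g s), ← mul_inv_cancel_left (g s) (permAct ρ g s),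
      map_mul, map_mul π (g s) ((g s)⁻¹ * permAct ρ g s)]
    refine Commute.mul_right (Commute.mul_left (Commute.refl _) (hcen _ (hg σ s) _)) ?_
    exact Commute.mul_left (hcen _ (hg ρ s) _).symm (hcen _ (hg σ s) _)
  -- Applying `τ` only reorders the factors, by left translation.
  have hperm : (Finset.univ : Finset (Equiv.Perm (Fin N))).toList.Perm
      (Finset.univ.toList.map (τ * ·)) := by
    rw [List.perm_ext_iff_of_nodup (Finset.nodup_toList _)
      ((Finset.nodup_toList _).map (mul_right_injective τ))]
    intro σ
    simp only [Finset.mem_toList, Finset.mem_univ, List.mem_map, true_and, true_iff]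
    exact ⟨τ⁻¹ * σ, mul_inv_cancel_left τ σ⟩
  rw [← QuotientGroup.eq]
  change π _ = π _
  simp only [permListProd, permAct, map_list_prod, List.map_map]
  have h := (hperm.map fun σ => π (permAct σ g s)).prod_eq' (List.pairwise_map.2
    (List.Pairwise.imp (fun _ => hcomm _ _) (List.pairwise_of_forall fun _ _ => trivial)))
  rw [List.map_map] at h
  exact h

theorem permAct_permListProd_symmList [Group.IsNilpotent G] (f : (Fin N → S) → G)
    (τ : Equiv.Perm (Fin N)) :
    permAct τ (permListProd (symmList N (Group.nilpotencyClass G)) f) =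
      permListProd (symmList N (Group.nilpotencyClass G)) f := by
  have h : ∀ (k : ℕ) (τ : Equiv.Perm (Fin N)) (s : Fin N → S),
      (permListProd (symmList N k) f s)⁻¹ * permAct τ (permListProd (symmList N k) f) s ∈
        (⊤ : Subgroup G).lowerCentralSeries k := by
    intro k
    induction k with
    | zero => exact fun _ _ => Subgroup.mem_top _
    | succ k ih =>
      rw [show permListProd (symmList N (k + 1)) f =
        permListProd Finset.univ.toList (permListProd (symmList N k) f) from
          funext fun s => permListProd_flatMap_map _ _ f s]
      exact permListProd_univ_mem _ k ih
  funext s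
  have := h (Group.nilpotencyClass G) τ s
  rw [Subgroup.lowerCentralSeries_nilpotencyClass, Subgroup.mem_bot] at this
  exact (inv_mul_eq_one.1 this).symm

theorem isPolynomialMap_permListProd [Add S] [Group.IsNilpotent G] {f : (Fin N → S) → G}
    (hf : IsPolynomialMap f) (L : List (Equiv.Perm (Fin N))) :
    IsPolynomialMap (permListProd L f) := by
  obtain ⟨d, hd⟩ := hf
  obtain ⟨Q, hQ, hpoly⟩ := exists_subgroup_isPolynomialMap (G := G) (Fin N → S) d
  rw [show permListProd L f = (L.map fun σ => permAct σ f).prod by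
    funext s
    change _ = Pi.evalMonoidHom (fun _ => G) s (L.map fun σ => permAct σ f).prod
    rw [permListProd, map_list_prod, List.map_map]
    rfl]
  refine hpoly _ (list_prod_mem fun g hg => ?_)
  obtain ⟨σ, -, rfl⟩ := List.mem_map.1 hg
  exact hQ _ (hd.comp (fun (s : Fin N → S) i => s (σ i)) fun _ _ => rfl)

end Symmetrization

end PolyMap

namespace PolyMap

/-! ### Finite index in finitely generated nilpotent groups -/

section FiniteIndex

open Subgroup
open scoped commutatorElement

variable {G : Type*} [Group G]

theorem exists_finite_subset_mem_closure {X : Set G} {g : G} (hg : g ∈ closure X) :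
    ∃ F ⊆ X, F.Finite ∧ g ∈ closure F := by
  induction hg using closure_induction with
  | mem x hx => exact ⟨{x}, by simpa using hx, Set.finite_singleton x, subset_closure rfl⟩
  | one => exact ⟨∅, Set.empty_subset _, Set.finite_empty, one_mem _⟩
  | mul x y _ _ hx hy =>
    obtain ⟨F₁, h₁, f₁, m₁⟩ := hx
    obtain ⟨F₂, h₂, f₂, m₂⟩ := hy
    exact ⟨F₁ ∪ F₂, Set.union_subset h₁ h₂, f₁.union f₂,
      mul_mem (closure_mono Set.subset_union_left m₁) (closure_mono Set.subset_union_right m₂)⟩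
  | inv x _ hx =>
    obtain ⟨F, h, f, m⟩ := hx
    exact ⟨F, h, f, inv_mem m⟩

theorem exists_finite_subset_closure_eq_top [Group.FG G] {X : Set G} (hX : closure X = ⊤) :
    ∃ F ⊆ X, F.Finite ∧ closure F = ⊤ := by
  obtain ⟨T, hT, hTf⟩ := Group.fg_iff.1 ‹Group.FG G›
  choose F hFX hF hmem using fun g : G =>
    exists_finite_subset_mem_closure (hX.symm ▸ mem_top g : g ∈ closure X)
  refine ⟨⋃ t ∈ T, F t, Set.iUnion₂_subset fun t _ => hFX t, hTf.biUnion fun t _ => hF t, ?_⟩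
  rw [eq_top_iff, ← hT, closure_le]
  exact fun t ht => closure_mono (Set.subset_biUnion_of_mem (u := F) ht) (hmem t)

/-- A subgroup containing the commutator subgroup, and a positive power of each of finitely many
elements which generate the group together with it, has finite index. -/
theorem index_ne_zero_of_commutator_le {B : Subgroup G} (hB : commutator G ≤ B) {F : Set G}
    (hF : F.Finite) (hgen : closure F ⊔ B = ⊤) (hpow : ∀ x ∈ F, ∃ e, 0 < e ∧ x ^ e ∈ B) :
    B.index ≠ 0 := by
  have : B.Normal := Subgroup.Normal.of_commutator_le G hB
  have hc : IsMulCommutative (G ⧸ B) := Normal.quotient_commutative_iff_commutator_le.2 hB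
  let _ : CommGroup (G ⧸ B) := { mul_comm := hc.is_comm.comm }
  have htop : closure (QuotientGroup.mk' B '' F) = ⊤ := by
    have h := congrArg (map (QuotientGroup.mk' B)) hgen
    rwa [Subgroup.map_sup, MonoidHom.map_closure, (map_eq_bot_iff B).2 (QuotientGroup.ker_mk' B).ge,
      sup_bot_eq, map_top_of_surjective _ (QuotientGroup.mk'_surjective B)] at h
  have hfg : Group.FG (G ⧸ B) := Group.fg_iff.2 ⟨_, htop, hF.image _⟩
  have htors : closure (QuotientGroup.mk' B '' F) ≤ CommGroup.torsion (G ⧸ B) := by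
    rw [closure_le]
    rintro _ ⟨x, hx, rfl⟩
    obtain ⟨e, he, hxe⟩ := hpow x hx
    refine isOfFinOrder_iff_pow_eq_one.2 ⟨e, he, ?_⟩
    rw [← map_pow]
    exact (QuotientGroup.eq_one_iff _).2 hxe
  have : Finite (G ⧸ B) := CommGroup.finite_of_fg_isMulTorsion _ fun x =>
    htors (htop.symm ▸ mem_top x)
  exact index_ne_zero_of_finite

theorem relIndex_ne_zero_of_commutator_le {A B : Subgroup G} (hB : ⁅A, A⁆ ≤ B) {F : Set G}
    (hF : F.Finite) (hFA : F ⊆ A) (hgen : A ≤ closure F ⊔ (B ⊓ A))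
    (hpow : ∀ x ∈ F, ∃ e, 0 < e ∧ x ^ e ∈ B) : B.relIndex A ≠ 0 := by
  have himg : A.subtype '' (A.subtype ⁻¹' F) = F :=
    Set.image_preimage_eq_of_subset (by simpa using hFA)
  refine index_ne_zero_of_commutator_le (F := A.subtype ⁻¹' F) ?_
    (hF.preimage A.subtype_injective.injOn) ?_ fun x hx => ?_
  · rw [subgroupOf, ← map_le_iff_le_comap, map_subtype_commutator]
    exact hB
  · apply map_injective A.subtype_injective
    rw [Subgroup.map_sup, MonoidHom.map_closure, himg, subgroupOf_map_subtype, ← MonoidHom.range_eq_map,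
      range_subtype]
    exact le_antisymm (sup_le ((closure_le _).2 hFA) inf_le_right) hgen
  · obtain ⟨e, he, h⟩ := hpow _ hx
    exact ⟨e, he, h⟩

theorem relIndex_sup_eq_of_le_normalizer {A B : Subgroup G}
    (h : A ≤ normalizer (B : Set G)) : B.relIndex (A ⊔ B) = B.relIndex A := by
  have := normal_subgroupOf_of_le_normalizer h
  have := normal_subgroupOf_sup_of_le_normalizer h
  exact (Nat.card_congr (QuotientGroup.quotientInfEquivProdNormalizerQuotient A B h).toEquiv).symm

theorem commutatorElement_pow_pow {a b : G} (h : ∀ x, Commute ⁅a, b⁆ x) (p q : ℕ) :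
    ⁅a ^ p, b ^ q⁆ = ⁅a, b⁆ ^ (p * q) := by
  have key : ∀ {c y : G} (_ : ∀ x, Commute ⁅c, y⁆ x) (n : ℕ), ⁅c ^ n, y⁆ = ⁅c, y⁆ ^ n := by
    intro c y hc n
    induction n with
    | zero => simp
    | succ n ih =>
      rw [pow_succ' c, commutatorElement_mul_left_eq_conj_mul, ih]
      rw [← ((hc c).pow_left n).eq, mul_inv_cancel_right, pow_succ]
  have hb : ⁅a, b ^ q⁆ = ⁅a, b⁆ ^ q := by
    rw [← commutatorElement_inv, key (fun x => ?_) q, ← commutatorElement_inv, inv_pow, inv_inv]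
    rw [← commutatorElement_inv]
    exact (h x).inv_left
  rw [key (fun x => ?_) p, hb, ← pow_mul, mul_comm]
  rw [hb]
  exact (h x).pow_left q

/-- Modulo the right-hand side, `F` commutes with the generators `X`, so the whole `i`-th term
becomes central. -/
theorem lowerCentralSeries_step {X F : Set G} (hX : closure X = ⊤) {i : ℕ}
    (hF : F ⊆ (⊤ : Subgroup G).lowerCentralSeries i)
    (hgen : (⊤ : Subgroup G).lowerCentralSeries i ≤
      closure F ⊔ (⊤ : Subgroup G).lowerCentralSeries (i + 1)) :
    (⊤ : Subgroup G).lowerCentralSeries (i + 1) ≤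
      closure (Set.image2 (fun x y => ⁅x, y⁆) F X) ⊔
        (⊤ : Subgroup G).lowerCentralSeries (i + 2) := by
  set D := closure (Set.image2 (fun x y => ⁅x, y⁆) F X) ⊔
        (⊤ : Subgroup G).lowerCentralSeries (i + 2) with hD
  have hDle : D ≤ (⊤ : Subgroup G).lowerCentralSeries (i + 1) := by
    refine sup_le ((closure_le _).2 ?_) (Subgroup.lowerCentralSeries_antitone _ (by lia))
    rintro _ ⟨x, hx, y, -, rfl⟩
    exact commutator_mem_commutator (hF hx) (mem_top y)
  have : D.Normal := commutator_top_right_le_iff.1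
    ((commutator_mono hDle le_rfl).trans (le_sup_right : _ ≤ D))
  set π := QuotientGroup.mk' D with hπ
  have hcomm : ∀ {x y : G}, ⁅x, y⁆ ∈ D ↔ Commute (π x) (π y) := by
    intro x y
    rw [← commutatorElement_eq_one_iff_commute, ← map_commutatorElement, ← MonoidHom.mem_ker,
      hπ, QuotientGroup.ker_mk']
  have hcenter : (⊤ : Subgroup G).lowerCentralSeries i ≤ (center (G ⧸ D)).comap π := by
    refine hgen.trans (sup_le ((closure_le _).2 fun x hx => ?_) fun x hx => ?_)
    · have hle : closure X ≤ (centralizer {π x}).comap π := (closure_le _).2 fun y hy => by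
        refine mem_centralizer_singleton_iff.2 ?_
        exact (hcomm.1 ((le_sup_left : _ ≤ D) (subset_closure ⟨x, hx, y, hy, rfl⟩))).symm
      refine mem_center_iff.2 fun g => ?_
      obtain ⟨g, rfl⟩ := QuotientGroup.mk'_surjective D g
      exact mem_centralizer_singleton_iff.1 (hle (hX.symm ▸ mem_top g))
    · refine mem_center_iff.2 fun g => ?_
      obtain ⟨g, rfl⟩ := QuotientGroup.mk'_surjective D g
      exact (hcomm.1 ((le_sup_right : _ ≤ D) (commutator_mem_commutator hx (mem_top g)))).symm
  refine commutator_le.2 fun x hx y _ => ?_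
  exact hcomm.2 (mem_center_iff.1 (hcenter hx) (π y)).symm

/-- Modulo term `i + 2` the bracket is bilinear here: `⁅x, y⁆ ^ (e * m) = ⁅x ^ e, y ^ m⁆`, and `x ^
e` may be replaced by its `K`-part, as the other part is central. -/
theorem exists_pow_commutator_mem {K : Subgroup G} {i m e : ℕ} {x y : G}
    (hx : x ∈ (⊤ : Subgroup G).lowerCentralSeries i) (hy : y ^ m ∈ K)
    (hxe : x ^ e ∈ K ⊔ (⊤ : Subgroup G).lowerCentralSeries (i + 1)) :
    ⁅x, y⁆ ^ (e * m) ∈ K ⊔ (⊤ : Subgroup G).lowerCentralSeries (i + 2) := by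
  set π := QuotientGroup.mk' ((⊤ : Subgroup G).lowerCentralSeries (i + 2)) with hπ
  have hcen : ∀ c ∈ (⊤ : Subgroup G).lowerCentralSeries (i + 1), ∀ x, Commute (π c) x := by
    intro c hc x
    obtain ⟨x, rfl⟩ := QuotientGroup.mk'_surjective _ x
    rw [← commutatorElement_eq_one_iff_commute, ← map_commutatorElement, ← MonoidHom.mem_ker,
      hπ, QuotientGroup.ker_mk']
    exact commutator_mem_commutator hc (mem_top x)
  obtain ⟨κ, hκ, c, hc, hκc⟩ := mem_sup_of_normal_right.1 hxe
  have hz : ∀ u, Commute ⁅π x, π y⁆ u := by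
    rw [← map_commutatorElement]
    exact hcen _ (commutator_mem_commutator hx (mem_top y))
  have hc1 : ⁅π c, π y ^ m⁆ = 1 := commutatorElement_eq_one_iff_commute.2 (hcen c hc _)
  have heq : π ⁅κ, y ^ m⁆ = π (⁅x, y⁆ ^ (e * m)) := by
    rw [map_pow, map_commutatorElement, map_commutatorElement, ← commutatorElement_pow_pow hz,
      ← map_pow, ← hκc, map_mul, commutatorElement_mul_left_eq_conj_mul, map_pow, hc1, mul_one, mul_inv_cancel,
      one_mul]
  have h := QuotientGroup.eq.1 heq
  rw [← mul_inv_cancel_left ⁅κ, y ^ m⁆ (⁅x, y⁆ ^ (e * m))]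
  refine mul_mem (mem_sup_left ?_) (mem_sup_right h)
  exact mul_mem (mul_mem (mul_mem hκ hy) (inv_mem hκ)) (inv_mem hy)

/-- In a nilpotent group generated by finitely many elements, a subgroup that contains a fixed
positive power of each generator has finite index. -/
theorem index_ne_zero_of_pow_mem [Group.IsNilpotent G] {X : Set G} (hXf : X.Finite)
    (hX : closure X = ⊤) {K : Subgroup G} {m : ℕ} (hm : 0 < m) (hK : ∀ x ∈ X, x ^ m ∈ K) :
    K.index ≠ 0 := by
  have hF : ∀ i, ∃ F : Set G, F.Finite ∧ F ⊆ (⊤ : Subgroup G).lowerCentralSeries i ∧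
      (⊤ : Subgroup G).lowerCentralSeries i ≤
        closure F ⊔ (⊤ : Subgroup G).lowerCentralSeries (i + 1) ∧
      ∀ x ∈ F, ∃ e, 0 < e ∧ x ^ e ∈ K ⊔ (⊤ : Subgroup G).lowerCentralSeries (i + 1) := by
    intro i
    induction i with
    | zero =>
      exact ⟨X, hXf, fun x _ => mem_top x, hX ▸ le_sup_left,
        fun x hx => ⟨m, hm, mem_sup_left (hK x hx)⟩⟩
    | succ i ih =>
      obtain ⟨F, hFf, hFi, hgen, hpow⟩ := ih
      refine ⟨Set.image2 (fun x y => ⁅x, y⁆) F X, hFf.image2 _ hXf, ?_,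
        lowerCentralSeries_step hX hFi hgen, ?_⟩
      · rintro _ ⟨x, hx, y, -, rfl⟩
        exact commutator_mem_commutator (hFi hx) (mem_top y)
      · rintro _ ⟨x, hx, y, hy, rfl⟩
        obtain ⟨e, he, hxe⟩ := hpow x hx
        exact ⟨e * m, Nat.mul_pos he hm, exists_pow_commutator_mem (hFi hx) (hK y hy) hxe⟩
  -- Descend the series. By the second isomorphism theorem each index `[KA : KC]` is measured inside
  -- `A`, where the quotient is finitely generated, abelian and torsion.
  have hstep : ∀ i, (K ⊔ (⊤ : Subgroup G).lowerCentralSeries i).index ≠ 0 := by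
    intro i
    induction i with
    | zero => simp
    | succ i ih =>
      obtain ⟨F, hFf, hFi, hgen, hpow⟩ := hF i
      set A := (⊤ : Subgroup G).lowerCentralSeries i
      set C := (⊤ : Subgroup G).lowerCentralSeries (i + 1)
      have hCA : C ≤ A := Subgroup.lowerCentralSeries_antitone _ (Nat.le_succ i)
      have hAC : ∀ H : Subgroup G, ⁅A, H⁆ ≤ C := fun H => commutator_mono le_rfl le_top
      have hnorm : A ≤ normalizer ((K ⊔ C : Subgroup G) : Set G) :=
        le_normalizer_iff_commutator_le_right.2 ((hAC _).trans le_sup_right)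
      have hrel : (K ⊔ C).relIndex A ≠ 0 := relIndex_ne_zero_of_commutator_le
        ((hAC _).trans le_sup_right) hFf hFi
        (hgen.trans (sup_le_sup le_rfl (le_inf le_sup_right hCA))) hpow
      rw [← relIndex_sup_eq_of_le_normalizer hnorm,
        show A ⊔ (K ⊔ C) = K ⊔ A by rw [sup_left_comm, sup_eq_left.2 hCA]] at hrel
      rw [← relIndex_mul_index (sup_le_sup le_rfl hCA : K ⊔ C ≤ K ⊔ A)]
      exact mul_ne_zero hrel ih
  have h := hstep (Group.nilpotencyClass G)
  rwa [Subgroup.lowerCentralSeries_nilpotencyClass, sup_bot_eq] at h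

/-- If the range of `h` generates a finitely generated nilpotent group, then the subgroup generated
by the `m`-th powers of its elements has finite index, for `m` positive. -/
theorem relIndex_imageSubgroup_ne_zero_of_pow_mem [Group.IsNilpotent G] {Y : Type*} {h : Y → G}
    (hfg : (imageSubgroup h).FG) {K : Subgroup G} {m : ℕ} (hm : 0 < m)
    (hK : ∀ y, h y ^ m ∈ K) : K.relIndex (imageSubgroup h) ≠ 0 := by
  have : Group.FG (imageSubgroup h) := (Group.fg_iff_subgroup_fg _).2 hfg
  have htop : closure ((imageSubgroup h).subtype ⁻¹' Set.range h) = ⊤ := closure_closure_coe_preimage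
  obtain ⟨F, hFX, hF, hFtop⟩ := exists_finite_subset_closure_eq_top htop
  refine index_ne_zero_of_pow_mem hF hFtop hm fun x hx => ?_
  obtain ⟨y, hy⟩ := hFX hx
  have := hK y
  rw [hy] at this
  exact this

end FiniteIndex

end PolyMap

/-! ### The main theorem -/

theorem mainTheorem11 {S G : Type*} [AddCommSemigroup S] [Nonempty S]
    [Group G] [Group.IsNilpotent G] (N n : ℕ) (hn : Group.nilpotencyClass G = n)
    (f : (Fin N → S) → G) (hf : PolyMap.IsPolynomialMap f) :
    ∃ σ : Fin (N.factorial ^ n) → Equiv.Perm (Fin N),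
      PolyMap.IsSymmetricPolynomialMap (PolyMap.permProd σ f) ∧
      ((PolyMap.imageSubgroup f).FG →
        PolyMap.IsFiniteIndexIn (PolyMap.imageSubgroup (PolyMap.diagRestrict f))
          (PolyMap.imageSubgroup f) →
        PolyMap.IsFiniteIndexIn (PolyMap.imageSubgroup (PolyMap.permProd σ f))
          (PolyMap.imageSubgroup f)) := by
  subst hn
  set L := PolyMap.symmList N (Group.nilpotencyClass G) with hL
  have hlen : L.length = N.factorial ^ Group.nilpotencyClass G := PolyMap.length_symmList _ _
  let σ : Fin (N.factorial ^ Group.nilpotencyClass G) → Equiv.Perm (Fin N) :=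
    fun i => L.get (i.cast hlen.symm)
  have hσ : PolyMap.permProd σ f = PolyMap.permListProd L f := by
    have hlist : List.ofFn σ = L := by
      rw [List.ofFn_congr hlen.symm]
      exact List.ofFn_get L
    funext s
    rw [PolyMap.permProd, PolyMap.permListProd, ← hlist, List.map_ofFn]
    rfl
  refine ⟨σ, ?_⟩
  rw [hσ]
  refine ⟨⟨PolyMap.isPolynomialMap_permListProd hf L, PolyMap.permAct_permListProd_symmList f⟩,
    fun hfg hdiag => ?_⟩
  have hle : PolyMap.imageSubgroup (PolyMap.permListProd L f) ≤ PolyMap.imageSubgroup f := by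
    refine (Subgroup.closure_le _).2 ?_
    rintro _ ⟨s, rfl⟩
    refine list_prod_mem fun g hg => ?_
    obtain ⟨τ, -, rfl⟩ := List.mem_map.1 hg
    exact Subgroup.subset_closure ⟨_, rfl⟩
  refine ⟨hle, Subgroup.finiteIndex_iff.2 ?_⟩
  obtain ⟨hdle, hdfin⟩ := hdiag
  -- Finite generation passes to subgroups of finite index.
  have hdfg : (PolyMap.imageSubgroup (PolyMap.diagRestrict f)).FG := by
    have : Group.FG (PolyMap.imageSubgroup f) := (Group.fg_iff_subgroup_fg _).2 hfg
    have := Subgroup.fg_of_index_ne_zero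
      ((PolyMap.imageSubgroup (PolyMap.diagRestrict f)).subgroupOf (PolyMap.imageSubgroup f))
    exact (Group.fg_iff_subgroup_fg _).1 (Group.fg_of_surjective
      (f := (Subgroup.subgroupOfEquivOfLe hdle).toMonoidHom)
      (Subgroup.subgroupOfEquivOfLe hdle).surjective)
  refine Subgroup.relIndex_ne_zero_trans (K := PolyMap.imageSubgroup (PolyMap.diagRestrict f))
    (PolyMap.relIndex_imageSubgroup_ne_zero_of_pow_mem hdfg
      (hlen ▸ pow_pos N.factorial_pos _ : 0 < L.length) fun s => ?_)
    (Subgroup.finiteIndex_iff.1 hdfin)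
  -- Permutations fix diagonal points, so the product there is a pure power of `f`.
  rw [PolyMap.diagRestrict, ← PolyMap.permListProd_const]
  exact Subgroup.subset_closure ⟨_, rfl⟩
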